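/- **Setting.** Let $d\ge 1$ and let $\mathbb T^d=\mathbb R^d/\mathbb Z^d$ be the flat torus with its quotient Euclidean distance $\|x-y\|$. A set $S\subseteq\mathbb T^d$ is a $(\lambda,\bar\mu)$-net if every point of $\mathbb T^d$ is at distance $<\lambda$ from a point of $S$ and distinct points of $S$ are at distance $\ge\bar\mu\lambda$. Let $L\subset\mathbb T^d$ be a finite $(\lambda,\bar\mu)$-net with $\lambda\le 1/4$ and $\bar\mu>0$, let $0\le\bar\rho<\bar\mu/4$, and let $L'=\{p' : p\in L\}$ be a perturbation of $L$ with $\|p'-p\|\le\bar\rho\lambda$ for all $p\in L$. Put $\lambda'=\lambda(1+\bar\rho)$ and $\bar\mu'=(\bar\mu-2\bar\rho)/(1+\bar\rho)$. A simplex is a non-empty finite subset $\sigma\subseteq L'$; it is a $d$-simplex if it has $d+1$ points. A Delaunay center of $\sigma$ is a point $x$ with $\|x-p\|\le\|x-q\|$ for all $p\in\sigma$, $q\in L'$ (for a $d$-simplex this is its circumcenter); $\mathrm{Del}(L')$ is the set of simplices that have a Delaunay center. A simplex $\sigma$ is $\eta$-protected at $x$ if $\|x-q\|>\|x-p\|+\eta$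 for all $p\in\sigma$, $q\in L'\setminus\sigma$. An $\alpha$-Delaunay center of $\sigma$ is a point $x$ with $\|x-p\|\le\|x-q\|+\alpha$ for all $p\in\sigma$, $q\in L'$. **Witnesses and pyramids.** Let $W$ be the set of centers of the cells of a cubical grid on $\mathbb T^d$ with cells of side $1/N$, $N\ge1$ an integer (with arbitrary origin), and let $\varepsilon=\sqrt d/N$ be the diameter of its cells. For a $d$-simplex $\sigma$ lifted to $\mathbb R^d$, let $\Omega^*$ be the axis-parallel cube of side $4\lambda'+8\varepsilon$ with the same center as the bounding box of the lift. The root of the pyramid of $\sigma$ is the block of $2^H\times\dots\times2^H$ cells of the (lifted) grid whose lowest cell is the grid cell containing the lower corner of $\Omega^*$, with $H$ least such that the block contains $\Omega^*$; for $0\le h\le H$, level $h$ is the subdivision of the root into $2^{hd}$ equal closed cubes. A cell of any level is full if it meets the bisecting hyperplane of every pair of vertices of the lift; a full-leaf-point is a point of $W$ that is the center of a full cell of level $H$ (a grid cell). **The complex $\mathrm{Del}^{2\varepsilon}_0(L',W)$.** For $\Theta_0>0$ put $n_0(\varepsilon)=U_d\left(\frac{4d}{\Theta_0\bar\mu'}\right)^d\log_2\frac{5\sqrt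 d\,\lambda'}{\varepsilon}$, with $U_d$ the volume of the Euclidean unit $d$-ball. The complex $\mathrm{Del}^{2\varepsilon}_0(L',W)$ consists of the non-empty faces of all $d$-simplices $\sigma\subseteq L'$ that lie in the closed ball of radius $2\lambda'+4\varepsilon$ around one of their vertices, have a full-leaf-point $w$ that is a $2\varepsilon$-Delaunay center of $\sigma$, and whose pyramid has, over all its levels, at most $n_0(\varepsilon)$ full cells. (The lift used is the one by the preimages of the vertices nearest to $w$.) **Statement.** Let $\delta=\bar\delta\lambda'$ with $8\varepsilon+\delta\le\lambda'$, and suppose that every $d$-simplex of $\mathrm{Del}(L')$ is $\delta$-protected at its circumcenter (that is, at each of its Delaunay centers). If $0<\Theta_0\le\frac{\bar\delta\bar\mu}{24d}$, then $\mathrm{Del}(L')\subseteq\mathrm{Del}^{2\varepsilon}_0(L',W)$. If, in addition, for every $d$-simplex $\sigma$ of $\mathrm{Del}^{2\varepsilon}_0(L',W)$ there are $\eta>0$ and a point $c$ equidistant from the vertices of $\sigma$ at which $\sigma$ is $\eta$-protected, then $\mathrm{Del}^{2\varepsilon}_0(L',W)=\mathrm{Del}(L')$. -/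

import Mathlib

open MeasureTheory

noncomputable section

namespace FlatDelaunay

/-! ### The flat torus -/

/-- Euclidean `d`-space. -/
abbrev E (d : ℕ) := EuclideanSpace ℝ (Fin d)

/-- The standard flat torus `ℝ^d / ℤ^d`: the `ℓ²`-product of `d` circles `ℝ / ℤ`, with
`dist x y = √(∑ i, dist (x i) (y i) ^ 2)`, which is the quotient of the Euclidean distance. -/
abbrev FlatTorus (d : ℕ) := PiLp 2 (fun _ : Fin d => UnitAddCircle)

/-- The quotient map `ℝ^d → ℝ^d / ℤ^d`. -/
def proj {d : ℕ} (x : E d) : FlatTorus d := WithLp.toLp 2 fun i => (x i : UnitAddCircle)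

/-! ### Nets, Delaunay complexes, protection -/

section Metric

variable {X : Type*} [MetricSpace X]

/-- `S` is an `r`-sample of the whole space. -/
def IsSample (S : Set X) (r : ℝ) : Prop := ∀ x : X, ∃ s ∈ S, dist x s < r

/-- `S` is a `(lam, mu)`-net: a `lam`-sample whose points are pairwise at distance at least
`mu * lam`; `mu` is the sparsity ratio. -/
def IsNet (S : Set X) (lam mu : ℝ) : Prop :=
  IsSample S lam ∧ ∀ p ∈ S, ∀ q ∈ S, p ≠ q → mu * lam ≤ dist p q

/-- `x` is a Delaunay center of the simplex `σ` with respect to `L`. Such an `x` is equidistant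
from the vertices of `σ` when `σ ⊆ L`; for a top-dimensional simplex it is the circumcenter. -/
def IsDelaunayCenter (L : Set X) (σ : Finset X) (x : X) : Prop :=
  ∀ p ∈ σ, ∀ q ∈ L, dist x p ≤ dist x q

/-- The Delaunay complex of `L`, as the set of its (nonempty) simplices. -/
def delaunayComplex (L : Set X) : Set (Finset X) :=
  {σ | σ.Nonempty ∧ (σ : Set X) ⊆ L ∧ ∃ x, IsDelaunayCenter L σ x}

/-- `σ` is `δ`-protected at `x`. -/
def IsProtectedAt (L : Set X) (δ : ℝ) (σ : Finset X) (x : X) : Prop :=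
  ∀ p ∈ σ, ∀ q ∈ L \ (σ : Set X), dist x p + δ < dist x q

/-- `x` is equidistant from all the vertices of `σ`. -/
def IsCircumcenter (σ : Finset X) (x : X) : Prop :=
  ∀ p ∈ σ, ∀ q ∈ σ, dist x p = dist x q

/-- `x` is an `α`-Delaunay center of `σ` with respect to `L`. -/
def IsRelaxedDelaunayCenter (L : Set X) (α : ℝ) (σ : Finset X) (x : X) : Prop :=
  ∀ p ∈ σ, ∀ q ∈ L, dist x p ≤ dist x q + α

end Metric

/-! ### The grid of witnesses -/

/-- A cubical grid on the torus: its cells are the images of the cubes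
`origin + (k + [0,1]^d) / N` for `k ∈ ℤ^d`. -/
structure WitnessGrid (d : ℕ) where
  N : ℕ
  N_pos : 0 < N
  origin : E d

namespace WitnessGrid

variable {d : ℕ} (G : WitnessGrid d)

/-- The resolution of the grid: the diameter `√d / N` of its cells. -/
def eps : ℝ := √(d : ℝ) / G.N

/-- The witnesses: the centers of the cells of the grid. -/
def witnesses : Set (FlatTorus d) :=
  Set.range fun k : Fin d → ℤ =>
    proj (WithLp.toLp 2 fun i => G.origin i + ((k i : ℝ) + 1 / 2) / G.N : E d)

end WitnessGrid

/-! ### Pyramids -/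

variable {d : ℕ}

/-- The closed axis-parallel cube with lower corner `a` and side length `r`. -/
def cube (a : E d) (r : ℝ) : Set (E d) := {x | ∀ i, a i ≤ x i ∧ x i ≤ a i + r}

/-- The center of `cube a r`. -/
def cubeCenter (a : E d) (r : ℝ) : E d := WithLp.toLp 2 fun i => a i + r / 2

/-- In the pyramid over the cube `cube a r`, the lower corner of the level-`h` cell with index
`j`. The cell itself is `cube (cellCorner a r h j) (r / 2 ^ h)`; its children are the `2 ^ d`
cells of level `h + 1` that subdivide it. -/
def cellCorner (a : E d) (r : ℝ) (h : ℕ) (j : Fin d → Fin (2 ^ h)) : E d :=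
  WithLp.toLp 2 fun i => a i + (j i : ℕ) * (r / 2 ^ h)

/-- A set (a cell) is full for `s` if it meets all the bisecting hyperplanes of `s`. -/
def IsFull (s : Finset (E d)) (Q : Set (E d)) : Prop :=
  ∀ p ∈ s, ∀ q ∈ s, p ≠ q → ∃ x ∈ Q, dist x p = dist x q

/-- The center of the smallest axis-parallel box containing `s`. -/
def boxCenter (s : Finset (E d)) : E d :=
  WithLp.toLp 2 fun i =>
    (sInf ((fun p : E d => p i) '' s) + sSup ((fun p : E d => p i) '' s)) / 2

/-- The lower corner of the cube with the same center as the bounding box of `s` and with side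
length `4 * lam + 4 * α`. -/
def omegaCorner (lam α : ℝ) (s : Finset (E d)) : E d :=
  WithLp.toLp 2 fun i => boxCenter s i - (2 * lam + 2 * α)

namespace WitnessGrid

variable (G : WitnessGrid d)

/-- The lower corner of the root of the pyramid of `s`: the lower corner of the cell of the grid
that contains `omegaCorner lam α s`. -/
def rootCorner (lam α : ℝ) (s : Finset (E d)) : E d :=
  WithLp.toLp 2 fun i => G.origin i + (⌊(omegaCorner lam α s i - G.origin i) * G.N⌋ : ℝ) / G.N

/-- The index of the last level of the pyramid of `s` (the root has level `0`): the least `h` such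
that the block of `2 ^ h × ⋯ × 2 ^ h` grid cells at `rootCorner lam α s` contains the cube of side
`4 * lam + 4 * α` around the bounding box of `s`. -/
def depth (lam α : ℝ) (s : Finset (E d)) : ℕ :=
  sInf {h : ℕ | cube (omegaCorner lam α s) (4 * lam + 4 * α) ⊆
    cube (G.rootCorner lam α s) (2 ^ h / G.N)}

/-- The side length of the root. The cells of the last level are thus grid cells, with side length
`1 / N` and diameter `eps`, and there is a witness at the center of each of them. -/
def rootSide (lam α : ℝ) (s : Finset (E d)) : ℝ := 2 ^ G.depth lam α s / G.N

/-- The level-`h` cell with index `j` of the pyramid of `s` is full. -/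
def IsFullCell (lam α : ℝ) (s : Finset (E d)) (h : ℕ) (j : Fin d → Fin (2 ^ h)) : Prop :=
  IsFull s (cube (cellCorner (G.rootCorner lam α s) (G.rootSide lam α s) h j)
    (G.rootSide lam α s / 2 ^ h))

/-- The number of full cells of the pyramid of `s`, over all its levels. -/
def numFullCells (lam α : ℝ) (s : Finset (E d)) : ℕ :=
  ∑ h ∈ Finset.range (G.depth lam α s + 1),
    Set.ncard {j : Fin d → Fin (2 ^ h) | G.IsFullCell lam α s h j}

/-- The full-leaf-points of `s`: the witnesses (unwrapped to `ℝ^d`) at the centers of the full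
cells of the last level of the pyramid. -/
def fullLeafPoints (lam α : ℝ) (s : Finset (E d)) : Set (E d) :=
  {w | proj w ∈ G.witnesses ∧ ∃ j : Fin d → Fin (2 ^ G.depth lam α s),
    G.IsFullCell lam α s (G.depth lam α s) j ∧
    w = cubeCenter (cellCorner (G.rootCorner lam α s) (G.rootSide lam α s)
      (G.depth lam α s) j) (G.rootSide lam α s / 2 ^ G.depth lam α s)}

end WitnessGrid

/-! ### The complex `Del₀^{2ε}` -/

/-- The volume of the unit ball of Euclidean `d`-space. -/
def unitBallVolume (d : ℕ) : ℝ := (volume (Metric.ball (0 : E d) 1)).toReal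

/-- The threshold on the number of full cells,
`U_d (4 d / (Θ₀ μ))^d log₂ (5 √d lam / ε)`. -/
def fullCellBound (d : ℕ) (lam mu ε Θ₀ : ℝ) : ℝ :=
  unitBallVolume d * (4 * d / (Θ₀ * mu)) ^ d * Real.logb 2 (5 * √(d : ℝ) * lam / ε)

/-- The `d`-simplices of `L` that are kept: those contained in the ball of radius
`2 * lam + 4 * ε` around one of their vertices, which have a full-leaf-point that is a
`2ε`-Delaunay center, and whose pyramid has at most `fullCellBound` full cells. The pyramid lives
in `ℝ^d`, over the lift `s` of `σ` that consists of the preimages of the vertices nearest to the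
full-leaf-point. -/
def keptSimplices (L : Set (FlatTorus d)) (G : WitnessGrid d) (lam mu Θ₀ : ℝ) :
    Set (Finset (FlatTorus d)) :=
  {σ | (σ : Set (FlatTorus d)) ⊆ L ∧ σ.card = d + 1 ∧
    (∃ p ∈ σ, ∀ q ∈ σ, q ∈ Metric.closedBall p (2 * lam + 4 * G.eps)) ∧
    ∃ s : Finset (E d), Set.BijOn proj (s : Set (E d)) (σ : Set (FlatTorus d)) ∧
      (∃ w ∈ G.fullLeafPoints lam (2 * G.eps) s,
        (∀ p ∈ s, dist w p = dist (proj w) (proj p)) ∧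
        IsRelaxedDelaunayCenter L (2 * G.eps) σ (proj w)) ∧
      (G.numFullCells lam (2 * G.eps) s : ℝ) ≤ fullCellBound d lam mu G.eps Θ₀}

/-- The complex `Del₀^{2ε}(L, W)` for the witness set `W = G.witnesses` of resolution
`ε = G.eps`: the kept `d`-simplices and all their nonempty faces. -/
def keptComplex (L : Set (FlatTorus d)) (G : WitnessGrid d) (lam mu Θ₀ : ℝ) :
    Set (Finset (FlatTorus d)) :=
  {τ | τ.Nonempty ∧ ∃ σ ∈ keptSimplices L G lam mu Θ₀, τ ⊆ σ}

end FlatDelaunay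

end

open FlatDelaunay

/-! Lift the perturbed net to its periodic preimage `P` in ℝ^d. Among the Delaunay centers of a
lifted simplex, which form a compact set, one at maximal distance from a vertex has nearest sites
that affinely span ℝ^d (`exists_subset_nearest_spanning`); protection then leaves exactly d + 1 of
them (`exists_finset_nearest`). So every Delaunay simplex is a face of a nondegenerate protected
d-simplex with some circumcenter c. The grid cell containing c is full, because c lies on all
bisectors, and its center is within ε of c, hence a 2ε-Delaunay center.

The count of full cells rests on a quantitative nondegeneracy (`norm_gradient_le`): slide the center
away from a vertex along the Voronoi edge dual to the opposite facet until a new site appears. The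
facet and the new site form another protected simplex, and this bounds the altitude from below.
Hence points near all bisectors are near c (`dist_circumcenter_le`): full cells of side r lie in a
ball around c of radius proportional to r, and comparing volumes (`ncard_mul_pow_le`) bounds their
number on a level independently of the level. Rounding in the number of levels is absorbed by the
small top levels (`numFullCells_le`).

Conversely, protection at a point equidistant from the vertices makes that point a Delaunay center.
-/

namespace FlatDelaunay
open Filter Topology

variable {d : ℕ}

/-- The points of `P` that are closest to `x`. -/
def nearest {X : Type*} [MetricSpace X] (P : Set X) (x : X) : Set X :=
  {p | p ∈ P ∧ ∀ q ∈ P, dist x p ≤ dist x q}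

theorem dist_eq_of_mem_nearest {X : Type*} [MetricSpace X] {P : Set X} {x p q : X}
    (hp : p ∈ nearest P x) (hq : q ∈ nearest P x) : dist x p = dist x q :=
  le_antisymm (hp.2 q hq.1) (hq.2 p hp.1)

theorem isDelaunayCenter_iff_subset_nearest {X : Type*} [MetricSpace X] {L : Set X} {σ : Finset X}
    (hσ : (σ : Set X) ⊆ L) {x : X} : IsDelaunayCenter L σ x ↔ (σ : Set X) ⊆ nearest L x :=
  ⟨fun h _ hp => ⟨hσ hp, h _ hp⟩, fun h _ hp => (h hp).2⟩

theorem isClosed_setOf_subset_nearest {X : Type*} [MetricSpace X] (P σ : Set X) :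
    IsClosed {y : X | σ ⊆ nearest P y} := by
  have : {y : X | σ ⊆ nearest P y} =
      {y | σ ⊆ P} ∩ ⋂ p ∈ σ, ⋂ q ∈ P, {y | dist y p ≤ dist y q} := by
    ext y
    simp only [Set.mem_ofPred_eq, Set.mem_inter_iff, Set.mem_iInter]
    exact ⟨fun h => ⟨fun p hp => (h hp).1, fun p hp => (h hp).2⟩,
      fun h p hp => ⟨h.1 hp, h.2 p hp⟩⟩
  rw [this]
  refine isClosed_const.inter ?_
  refine isClosed_biInter fun p _ => isClosed_biInter fun q _ => ?_
  exact isClosed_le (by fun_prop) (by fun_prop)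

/-! ### Moving Delaunay centers in Euclidean space -/

section Euclidean

variable {V : Type*} [NormedAddCommGroup V] [InnerProductSpace ℝ V]

/-- The quadratic terms in `t` cancel, so the power difference of two sites is affine along a line.
-/
theorem dist_add_smul_sq_sub (x v p q : V) (t : ℝ) :
    dist (x + t • v) q ^ 2 - dist (x + t • v) p ^ 2 =
      dist x q ^ 2 - dist x p ^ 2 + 2 * t * inner ℝ v (p - q) := by
  have h : ∀ z : V, dist (x + t • v) z ^ 2 =
      dist x z ^ 2 + 2 * t * inner ℝ v (x - z) + ‖t • v‖ ^ 2 := by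
    intro z
    rw [dist_eq_norm, dist_eq_norm, show x + t • v - z = (x - z) + t • v by abel,
      norm_add_sq_real, real_inner_smul_right, real_inner_comm]
    ring
  rw [h, h, show p - q = (x - q) - (x - p) by abel, inner_sub_right v (x - q)]
  ring

/-- Only finitely many sites compete for small `t`: strict inequalities persist by continuity, and
ties at `x` are decided by the sign of the linear term, which `hv` controls. -/
theorem eventually_subset_nearest {P σ : Set V}
    (hfin : ∀ x r, (P ∩ Metric.closedBall x r).Finite) {x v : V} (hσ : σ ⊆ nearest P x)
    (hv : ∀ p ∈ σ, ∀ q ∈ nearest P x, inner ℝ v q ≤ inner ℝ v p) :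
    ∀ᶠ t : ℝ in 𝓝[>] 0, σ ⊆ nearest P (x + t • v) := by
  rcases σ.eq_empty_or_nonempty with rfl | ⟨p₀, hp₀⟩
  · simp
  set R := dist x p₀
  have hR : ∀ p ∈ σ, dist x p = R := fun p hp => dist_eq_of_mem_nearest (hσ hp) (hσ hp₀)
  have hsF : σ ⊆ P ∩ Metric.closedBall x (R + 1) := fun p hp =>
    ⟨(hσ hp).1, by rw [Metric.mem_closedBall, dist_comm, hR p hp]; linarith⟩
  have hcont : ∀ p : V, Tendsto (fun t : ℝ => dist (x + t • v) p) (𝓝[>] 0) (𝓝 (dist x p)) := by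
    intro p
    have : Continuous fun t : ℝ => dist (x + t • v) p := by fun_prop
    simpa using this.continuousAt.mono_left (nhdsWithin_le_nhds (a := (0 : ℝ)) (s := Set.Ioi 0))
  have h1 : ∀ᶠ t : ℝ in 𝓝[>] 0, ∀ p ∈ σ, ∀ q ∈ P ∩ Metric.closedBall x (R + 1),
      dist (x + t • v) p ≤ dist (x + t • v) q := by
    rw [Filter.eventually_all_finite ((hfin x (R + 1)).subset hsF)]
    intro p hp
    rw [Filter.eventually_all_finite (hfin x (R + 1))]
    intro q hq
    by_cases hqn : q ∈ nearest P x
    · filter_upwards [self_mem_nhdsWithin] with t ht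
      have h := dist_add_smul_sq_sub x v p q t
      rw [dist_eq_of_mem_nearest hqn (hσ hp), inner_sub_right] at h
      have := mul_nonneg (mul_nonneg zero_le_two (le_of_lt ht)) (sub_nonneg.2 (hv p hp q hqn))
      refine le_of_sq_le_sq ?_ dist_nonneg
      linarith
    · have hlt : dist x p < dist x q := by
        by_contra hle
        refine hqn ⟨hq.1, fun z hz => (not_lt.1 hle).trans ((hσ hp).2 z hz)⟩
      exact ((hcont p).eventually_lt (hcont q) hlt).mono fun t ht => ht.le
  -- Half of the slack 1 in the radius `R + 1`: after such a move sites outside that ball are still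
  -- farther than those of `σ`.
  have h2 : ∀ᶠ t : ℝ in 𝓝[>] 0, dist (x + t • v) x < 1 / 2 := by
    have := hcont x
    rw [dist_self] at this
    exact this.eventually_lt_const (by norm_num)
  filter_upwards [h1, h2] with t ht1 ht2 p hp
  refine ⟨(hσ hp).1, fun q hq => ?_⟩
  by_cases hqF : q ∈ Metric.closedBall x (R + 1)
  · exact ht1 p hp q ⟨hq, hqF⟩
  · rw [Metric.mem_closedBall, dist_comm, not_le] at hqF
    have a := dist_triangle (x + t • v) x p
    have b := dist_triangle_left x q (x + t • v)
    rw [hR p hp] at a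
    linarith

/-- At a center farthest from a vertex, a direction orthogonal to all differences of nearest sites
could be followed both ways. One of the two moves would increase the distance. -/
theorem exists_subset_nearest_spanning [FiniteDimensional ℝ V] {P σ : Set V} {Λ : ℝ}
    (hfin : ∀ x r, (P ∩ Metric.closedBall x r).Finite)
    (hsample : ∀ x, ∃ p ∈ P, dist x p < Λ) {x : V} (hne : σ.Nonempty) (hσ : σ ⊆ nearest P x) :
    ∃ y, σ ⊆ nearest P y ∧
      ∀ v : V, (∀ p ∈ nearest P y, ∀ q ∈ nearest P y, inner ℝ v (p - q) = 0) → v = 0 := by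
  obtain ⟨p₀, hp₀⟩ := hne
  have hcpt : IsCompact {y : V | σ ⊆ nearest P y} := by
    refine Metric.isCompact_of_isClosed_isBounded (isClosed_setOf_subset_nearest P σ) ?_
    refine (Metric.isBounded_closedBall (x := p₀) (r := Λ)).subset fun y hy => ?_
    obtain ⟨p, hp, hlt⟩ := hsample y
    exact ((hy hp₀).2 p hp).trans hlt.le
  obtain ⟨y, hy, hmax⟩ := hcpt.exists_isMaxOn ⟨x, hσ⟩
    (f := fun y => dist y p₀) (by fun_prop)
  refine ⟨y, hy, fun v hv => ?_⟩
  have hv' : ∀ p ∈ nearest P y, ∀ q ∈ nearest P y, inner ℝ v p = inner ℝ v q := fun p hp q hq => by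
    have := hv p hp q hq
    rw [inner_sub_right] at this
    linarith
  have e1 := eventually_subset_nearest hfin hy (v := v) fun p hp q hq => (hv' q hq p (hy hp)).le
  have e2 := eventually_subset_nearest hfin hy (v := -v) fun p hp q hq => by
    rw [inner_neg_left, inner_neg_left, hv' q hq p (hy hp)]
  obtain ⟨t, h1, h2, ht⟩ := (e1.and (e2.and self_mem_nhdsWithin)).exists
  have m1 : dist (y + t • v) p₀ ≤ dist y p₀ := hmax h1
  have m2 : dist (y + t • -v) p₀ ≤ dist y p₀ := hmax h2
  -- Neither of `y ± t • v` is farther from `p₀` than `y`, so the parallelogram law forces `t • v =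
  -- 0`.
  have par := parallelogram_law_with_norm ℝ (y - p₀) (t • v)
  rw [dist_eq_norm, dist_eq_norm] at m1 m2
  rw [show y - p₀ + t • v = y + t • v - p₀ by abel,
    show y - p₀ - t • v = y + t • -v - p₀ by rw [smul_neg]; abel] at par
  have n1 := mul_self_le_mul_self (norm_nonneg _) m1
  have n2 := mul_self_le_mul_self (norm_nonneg _) m2
  have : ‖t • v‖ * ‖t • v‖ ≤ 0 := by nlinarith
  have h0 : ‖t • v‖ = 0 := by nlinarith [norm_nonneg (t • v)]
  rw [norm_eq_zero, smul_eq_zero] at h0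
  exact h0.resolve_left (ne_of_gt ht)

/-- Every `(finrank + 1)`-subset of a set of nearest points is `δ`-protected. -/
def ProtectedTops (P : Set V) (δ : ℝ) : Prop :=
  ∀ (y : V) (T : Finset V), (T : Set V) ⊆ nearest P y → T.card = Module.finrank ℝ V + 1 →
    ∀ p ∈ T, ∀ q ∈ P, q ∉ T → dist y p + δ < dist y q

theorem span_sub_eq_top [DecidableEq V] [FiniteDimensional ℝ V] {T : Finset V} (p₀ : V)
    (hspan : ∀ v : V, (∀ p ∈ T, ∀ q ∈ T, inner ℝ v (p - q) = 0) → v = 0) :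
    Submodule.span ℝ (Set.range fun p : {p // p ∈ T.erase p₀} => (p : V) - p₀) = ⊤ := by
  rw [← Submodule.orthogonal_eq_bot_iff, Submodule.eq_bot_iff]
  intro v hv
  rw [Submodule.mem_orthogonal] at hv
  have h : ∀ p ∈ T, inner ℝ v (p - p₀) = 0 := by
    intro p hp
    by_cases hpp : p = p₀
    · simp [hpp]
    · rw [real_inner_comm]
      exact hv _ (Submodule.subset_span ⟨⟨p, Finset.mem_erase.2 ⟨hpp, hp⟩⟩, rfl⟩)
  refine hspan v fun p hp q hq => ?_
  rw [show p - q = (p - p₀) - (q - p₀) by abel, inner_sub_right, h p hp, h q hq, sub_zero]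

/-- Spanning requires at least `finrank + 1` nearest sites; one more would be tied with a protected
subset of that size. -/
theorem exists_finset_nearest [FiniteDimensional ℝ V] {P : Set V} {Λ δ : ℝ} (hδ : 0 < δ)
    (hfin : ∀ x r, (P ∩ Metric.closedBall x r).Finite)
    (hsample : ∀ x, ∃ p ∈ P, dist x p < Λ) (hprot : ProtectedTops P δ) {y : V}
    (hne : (nearest P y).Nonempty)
    (hspan : ∀ v : V, (∀ p ∈ nearest P y, ∀ q ∈ nearest P y, inner ℝ v (p - q) = 0) → v = 0) :
    ∃ T : Finset V, (T : Set V) = nearest P y ∧ T.card = Module.finrank ℝ V + 1 := by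
  classical
  have hf : (nearest P y).Finite := by
    refine (hfin y Λ).subset fun p hp => ⟨hp.1, ?_⟩
    obtain ⟨q, hq, hlt⟩ := hsample y
    rw [Metric.mem_closedBall, dist_comm]
    exact (hp.2 q hq).trans hlt.le
  obtain ⟨T, hT⟩ := hf.exists_finset_coe
  obtain ⟨p₀, hp₀⟩ := hne
  rw [← hT] at hspan hp₀
  have hcard : Module.finrank ℝ V + 1 ≤ T.card := by
    have h1 := finrank_range_le_card (R := ℝ) fun p : {p // p ∈ T.erase p₀} => (p : V) - p₀
    rw [Set.finrank, span_sub_eq_top p₀ hspan, finrank_top, Fintype.card_coe,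
      Finset.card_erase_of_mem hp₀] at h1
    have : 0 < T.card := Finset.card_pos.2 ⟨p₀, hp₀⟩
    omega
  obtain ⟨S, hST, hS⟩ := Finset.exists_subset_card_eq hcard
  have hSn : (S : Set V) ⊆ nearest P y := hT ▸ Finset.coe_subset.2 hST
  refine ⟨T, hT, ?_⟩
  suffices T ⊆ S by rw [Finset.Subset.antisymm this hST, hS]
  intro q hq
  by_contra hqS
  have hqn : q ∈ nearest P y := hT ▸ Finset.mem_coe.2 hq
  obtain ⟨p, hp⟩ : S.Nonempty := Finset.card_pos.1 (by omega)
  have := hprot y S hSn hS p hp q hqn.1 hqS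
  rw [dist_eq_of_mem_nearest (hSn hp) hqn] at this
  linarith

/-! ### Quantitative nondegeneracy of protected simplices -/

/-- Bound on the gradient of a barycentric coordinate of a protected top simplex. -/
theorem norm_gradient_le [DecidableEq V] {P : Set V} {Λ δ m : ℝ} (hδ : 0 < δ)
    (hfin : ∀ x r, (P ∩ Metric.closedBall x r).Finite)
    (hsample : ∀ x, ∃ p ∈ P, dist x p < Λ) (hprot : ProtectedTops P δ)
    (hsep : ∀ p ∈ P, ∀ q ∈ P, p ≠ q → m ≤ dist p q)
    {y p s₀ g : V} {T : Finset V} (hT : (T : Set V) = nearest P y)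
    (hcard : T.card = Module.finrank ℝ V + 1) (hp : p ∈ T) (hs₀ : s₀ ∈ T.erase p)
    (hg : ∀ q ∈ T.erase p, inner ℝ g q = inner ℝ g s₀)
    (hgp : inner ℝ g (p - s₀) = 1) : ‖g‖ * (m * δ) ≤ 4 * Λ := by
  have hg0 : 0 < ‖g‖ := norm_pos_iff.2 fun h => by simp [h] at hgp
  have hΛ : ∀ z, ∀ q ∈ nearest P z, dist z q < Λ := fun z q hq => by
    obtain ⟨r, hr, hlt⟩ := hsample z
    exact (hq.2 r hr).trans_lt hlt
  have hS : ((T.erase p : Finset V) : Set V) ⊆ nearest P y := fun q hq => by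
    rw [← hT]
    exact Finset.mem_of_mem_erase hq
  -- Both centers are within `Λ` of `s₀`, so the slide has length less than `2 * Λ`.
  have hbd : ∀ t : ℝ, 0 ≤ t → ((T.erase p : Finset V) : Set V) ⊆ nearest P (y + t • -g) →
      t * ‖g‖ < 2 * Λ := by
    intro t ht h
    have h1 := hΛ _ _ (h hs₀)
    have h2 := hΛ _ _ (hS hs₀)
    have h3 := dist_triangle_right y (y + t • -g) s₀
    rw [dist_self_add_right, norm_smul, norm_neg, Real.norm_of_nonneg ht] at h3
    linarith
  let K : Set ℝ := {t | 0 ≤ t ∧ ((T.erase p : Finset V) : Set V) ⊆ nearest P (y + t • -g)}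
  have hK : IsCompact K := by
    refine Metric.isCompact_of_isClosed_isBounded ?_ ?_
    · exact isClosed_Ici.inter ((isClosed_setOf_subset_nearest P _).preimage
        (f := fun t : ℝ => y + t • -g) (by fun_prop))
    · refine (Metric.isBounded_Icc 0 (2 * Λ / ‖g‖)).subset fun t ht => ⟨ht.1, ?_⟩
      rw [le_div_iff₀ hg0]
      exact (hbd t ht.1 ht.2).le
  obtain ⟨t, ⟨ht0, htS⟩, htmax⟩ := hK.exists_isMaxOn ⟨0, le_rfl, by simpa using hS⟩
    (f := fun t => t) continuousOn_id
  have hpy : p ∈ nearest P y := hT ▸ Finset.mem_coe.2 hp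
  have hgT : ∀ r ∈ T.erase p, ∀ q ∈ T, inner ℝ (-g) q ≤ inner ℝ (-g) r := by
    intro r hr q hq
    rw [inner_neg_left, inner_neg_left, hg r hr]
    by_cases hqp : q = p
    · rw [inner_sub_right] at hgp
      rw [hqp]
      linarith
    · rw [hg q (Finset.mem_erase.2 ⟨hqp, hq⟩)]
  have htpos : 0 < t := by
    obtain ⟨u, hu, hu0⟩ := ((eventually_subset_nearest hfin hS (v := -g)
      fun r hr q hq => hgT r hr q (by rw [← hT] at hq; exact hq)).and self_mem_nhdsWithin).exists
    exact lt_of_lt_of_le hu0 (htmax (a := u) ⟨le_of_lt hu0, hu⟩)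
  set z := y + t • -g with hz
  -- The normalization `hgp` makes the power of `p` relative to the facet grow at rate exactly 2.
  have hpow : dist z p ^ 2 - dist z s₀ ^ 2 = 2 * t := by
    rw [hz, dist_add_smul_sq_sub, dist_eq_of_mem_nearest (hS hs₀) hpy, inner_neg_left,
      ← neg_sub p s₀, inner_neg_right, hgp]
    ring
  have hpz : p ∉ nearest P z := fun h => by
    rw [dist_eq_of_mem_nearest h (htS hs₀)] at hpow
    linarith
  -- If only facet vertices were nearest at `z`, the slide could continue past the maximal `t`.
  obtain ⟨q, hqz, hqS⟩ : ∃ q ∈ nearest P z, q ∉ T.erase p := by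
    by_contra! hcon
    obtain ⟨u, hu, hu0⟩ := ((eventually_subset_nearest hfin htS (v := -g)
      fun r hr q hq => hgT r hr q (Finset.mem_of_mem_erase (hcon q hq))).and
        self_mem_nhdsWithin).exists
    have hu0' : 0 < u := hu0
    have : t + u ≤ t := htmax (a := t + u) ⟨by linarith, by
      rw [add_smul, ← add_assoc]
      exact hu⟩
    linarith
  have hqp : q ≠ p := fun h => hpz (h ▸ hqz)
  -- The new simplex is protected at `z`, and `p` is now an outside site.
  have hlt := hprot z (insert q (T.erase p))
    (by
      rw [Finset.coe_insert]
      exact Set.insert_subset hqz htS)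
    (by
      rw [Finset.card_insert_of_notMem hqS, Finset.card_erase_add_one hp, hcard])
    s₀ (Finset.mem_insert_of_mem hs₀) p hpy.1
    (by simp [hqp.symm])
  have hR : m ≤ 2 * dist z s₀ := by
    have h1 := hsep q hqz.1 s₀ (htS hs₀).1 (fun h => hqS (h ▸ hs₀))
    have h2 := dist_triangle_left q s₀ z
    rw [dist_eq_of_mem_nearest hqz (htS hs₀)] at h2
    linarith
  have hd0 : 0 ≤ dist z s₀ := dist_nonneg
  -- With R the distance from `z` to `s₀`: `2 * t ≥ (R + δ)² - R² ≥ 2Rδ ≥ m * δ`.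
  have h5 : m * δ ≤ 2 * t := by nlinarith
  have h6 := hbd t ht0 htS
  nlinarith

/-- A point that is close to all bisectors of a protected top simplex is close to its
circumcenter. -/
theorem dist_circumcenter_le [FiniteDimensional ℝ V] {P : Set V} {Λ δ m κ : ℝ} (hδ : 0 < δ)
    (hm : 0 < m) (hκ : 0 ≤ κ)
    (hfin : ∀ x r, (P ∩ Metric.closedBall x r).Finite)
    (hsample : ∀ x, ∃ p ∈ P, dist x p < Λ) (hprot : ProtectedTops P δ)
    (hsep : ∀ p ∈ P, ∀ q ∈ P, p ≠ q → m ≤ dist p q)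
    {x y : V} {T : Finset V} (hT : (T : Set V) = nearest P y)
    (hcard : T.card = Module.finrank ℝ V + 1)
    (hspan : ∀ v : V, (∀ p ∈ T, ∀ q ∈ T, inner ℝ v (p - q) = 0) → v = 0)
    (hx : ∀ p ∈ T, ∀ q ∈ T, p ≠ q → |inner ℝ (x - y) (p - q)| ≤ κ * dist p q) :
    dist x y ≤ Module.finrank ℝ V * (4 * Λ / (m * δ) * (κ * (2 * Λ))) := by
  classical
  obtain ⟨p₀, hp₀⟩ : T.Nonempty := Finset.card_pos.1 (by omega)
  have hΛ : ∀ q ∈ T, dist y q < Λ := fun q hq => by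
    obtain ⟨r, hr, hlt⟩ := hsample y
    exact ((show q ∈ nearest P y from hT ▸ Finset.mem_coe.2 hq).2 r hr).trans_lt hlt
  have hΛ0 : 0 < Λ := dist_nonneg.trans_lt (hΛ p₀ hp₀)
  have hcardι : Fintype.card {p // p ∈ T.erase p₀} = Module.finrank ℝ V := by
    rw [Fintype.card_coe, Finset.card_erase_of_mem hp₀, hcard, Nat.add_sub_cancel]
  let b := basisOfTopLeSpanOfCardEqFinrank (fun p : {p // p ∈ T.erase p₀} => (p : V) - p₀)
    (span_sub_eq_top p₀ hspan).ge hcardι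
  have hb : ∀ i, b i = (i : V) - p₀ := fun i => by simp [b]
  have hcoord : ∀ i, |b.repr (x - y) i| ≤ 4 * Λ / (m * δ) * ‖x - y‖ := by
    intro i
    -- The Riesz vector of the coordinate is the gradient of the barycentric coordinate of vertex
    -- `i`, constant on the opposite facet.
    let g := (InnerProductSpace.toDual ℝ V).symm (LinearMap.toContinuousLinearMap (b.coord i))
    have hg : ∀ v, inner ℝ g v = b.repr v i := fun v => by
      simp [g, InnerProductSpace.toDual_symm_apply]
    have hi := Finset.mem_erase.1 i.2
    have hgb : ∀ j : {p // p ∈ T.erase p₀}, inner ℝ g ((j : V) - p₀) = if j = i then 1 else 0 := by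
      intro j
      rw [hg, ← hb, b.repr_self, Finsupp.single_apply]
    have hbound : ‖g‖ * (m * δ) ≤ 4 * Λ := by
      refine norm_gradient_le hδ hfin hsample hprot hsep hT hcard hi.2
        (Finset.mem_erase.2 ⟨hi.1.symm, hp₀⟩) (fun q hq => ?_) (by rw [hgb]; simp)
      by_cases hq0 : q = p₀
      · rw [hq0]
      · have hq' := Finset.mem_erase.1 hq
        have := hgb ⟨q, Finset.mem_erase.2 ⟨hq0, hq'.2⟩⟩
        rw [if_neg (fun h => hq'.1 (congrArg Subtype.val h)), inner_sub_right] at this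
        linarith
    rw [← hg]
    refine (abs_real_inner_le_norm _ _).trans (mul_le_mul_of_nonneg_right ?_ (norm_nonneg _))
    rwa [le_div_iff₀ (by positivity)]
  have hinner : ∀ i, |inner ℝ (x - y) (b i)| ≤ κ * (2 * Λ) := by
    intro i
    have hi := Finset.mem_erase.1 i.2
    rw [hb]
    refine (hx _ hi.2 _ hp₀ hi.1).trans (mul_le_mul_of_nonneg_left ?_ hκ)
    have := dist_triangle_left (i : V) p₀ y
    linarith [hΛ _ hi.2, hΛ _ hp₀]
  -- Expand one factor of the inner product in the edge basis: the gradient bounds control the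
  -- coordinates, and closeness to the bisectors controls the products with edges.
  have hsq : ‖x - y‖ * ‖x - y‖ ≤
      Module.finrank ℝ V * (4 * Λ / (m * δ) * (κ * (2 * Λ))) * ‖x - y‖ := by
    calc ‖x - y‖ * ‖x - y‖ = inner ℝ (x - y) (x - y) := (real_inner_self_eq_norm_mul_norm _).symm
      _ = inner ℝ (x - y) (∑ i, b.repr (x - y) i • b i) := by rw [b.sum_repr]
      _ = ∑ i, b.repr (x - y) i * inner ℝ (x - y) (b i) := by
          simp [inner_sum, real_inner_smul_right]
      _ ≤ ∑ _i : {p // p ∈ T.erase p₀}, (4 * Λ / (m * δ) * ‖x - y‖) * (κ * (2 * Λ)) := by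
          refine Finset.sum_le_sum fun i _ => (le_abs_self _).trans ?_
          rw [abs_mul]
          exact mul_le_mul (hcoord i) (hinner i) (abs_nonneg _) (by positivity)
      _ = _ := by
          rw [Finset.sum_const, Finset.card_univ, hcardι, nsmul_eq_mul]
          ring
  rw [dist_eq_norm]
  rcases (norm_nonneg (x - y)).eq_or_lt with h | h
  · rw [← h]
    positivity
  · exact le_of_mul_le_mul_right hsq h

end Euclidean

/-! ### The flat torus and its lift -/

theorem proj_apply (x : E d) (i : Fin d) : proj x i = (x i : UnitAddCircle) := rfl

theorem dist_coe_le (a b : ℝ) : dist (a : UnitAddCircle) b ≤ |a - b| := by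
  rw [dist_eq_norm, ← AddCircle.coe_sub, UnitAddCircle.norm_eq]
  simpa using round_le (a - b) 0

theorem dist_coe_eq {a b : ℝ} (h : |a - b| ≤ 1 / 2) : dist (a : UnitAddCircle) b = |a - b| := by
  rw [dist_eq_norm, ← AddCircle.coe_sub, AddCircle.norm_coe_eq_abs_iff _ one_ne_zero]
  simpa using h

theorem coe_eq_coe_iff {a b : ℝ} : (a : UnitAddCircle) = b ↔ ∃ n : ℤ, a - b = n := by
  rw [← sub_eq_zero, ← AddCircle.coe_sub, AddCircle.coe_eq_zero_iff]
  simp [eq_comm]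

theorem dist_proj_le (x y : E d) : dist (proj x) (proj y) ≤ dist x y := by
  rw [PiLp.dist_eq_of_L2, EuclideanSpace.dist_eq]
  refine Real.sqrt_le_sqrt (Finset.sum_le_sum fun i _ => ?_)
  gcongr
  exact dist_coe_le _ _

theorem dist_proj_eq {x y : E d} (h : ∀ i, |x i - y i| ≤ 1 / 2) :
    dist (proj x) (proj y) = dist x y := by
  rw [PiLp.dist_eq_of_L2, EuclideanSpace.dist_eq]
  congr 1
  refine Finset.sum_congr rfl fun i _ => ?_
  rw [proj_apply, proj_apply, dist_coe_eq (h i), Real.dist_eq]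

theorem abs_sub_apply_le (x y : E d) (i : Fin d) : |x i - y i| ≤ dist x y := by
  rw [dist_eq_norm]
  exact PiLp.norm_apply_le (x - y) i

theorem dist_proj_eq_of_dist_le {x y : E d} (h : dist x y ≤ 1 / 2) :
    dist (proj x) (proj y) = dist x y :=
  dist_proj_eq fun i => (abs_sub_apply_le x y i).trans h

/-- Rounding each coordinate separately gives the lift in the unit cube centered at `x`, where the
projection preserves distances to `x`. -/
theorem exists_lift_dist_eq (x : E d) (p : FlatTorus d) :
    ∃ y : E d, proj y = p ∧ dist x y = dist (proj x) p := by
  have h : ∀ i, ∃ b : ℝ, (b : UnitAddCircle) = p i ∧ |x i - b| ≤ 1 / 2 := by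
    intro i
    obtain ⟨c, hc⟩ := QuotientAddGroup.mk_surjective (p i)
    refine ⟨c + round (x i - c), ?_, ?_⟩
    · rw [← hc]
      exact coe_eq_coe_iff.2 ⟨round (x i - c), by ring⟩
    · rw [← sub_sub]
      exact abs_sub_round _
  choose b hb hb' using h
  have hp : proj (WithLp.toLp 2 b : E d) = p := by
    ext i
    exact hb i
  exact ⟨WithLp.toLp 2 b, hp, by rw [← hp, dist_proj_eq hb']⟩

theorem proj_surjective : Function.Surjective (proj (d := d)) := fun p =>
  let ⟨y, hy, _⟩ := exists_lift_dist_eq 0 p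
  ⟨y, hy⟩

theorem one_le_dist_of_proj_eq {x y : E d} (h : proj x = proj y) (hne : x ≠ y) :
    1 ≤ dist x y := by
  obtain ⟨i, hi⟩ : ∃ i, x i ≠ y i := by
    by_contra! hcon
    exact hne (by ext i; exact hcon i)
  have hi' : (x i : UnitAddCircle) = y i := congrArg (fun z : FlatTorus d => z i) h
  obtain ⟨n, hn⟩ := coe_eq_coe_iff.1 hi'
  refine le_trans ?_ (abs_sub_apply_le x y i)
  have hn0 : n ≠ 0 := fun h0 => hi (by rw [h0, Int.cast_zero] at hn; linarith)
  rw [hn, ← Int.cast_abs]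
  exact_mod_cast Int.one_le_abs hn0

theorem finite_preimage_proj_inter_closedBall {L : Set (FlatTorus d)} (hL : L.Finite) (x : E d)
    (r : ℝ) : (proj ⁻¹' L ∩ Metric.closedBall x r).Finite := by
  have hfib : ∀ p : FlatTorus d, (proj ⁻¹' {p} ∩ Metric.closedBall x r).Finite := by
    intro p
    obtain ⟨y, rfl⟩ := proj_surjective p
    let F : (Fin d → ℤ) → E d := fun k => WithLp.toLp 2 fun i => y i + k i
    refine ((Set.finite_Icc (fun i => ⌊x i - r - y i⌋) (fun i => ⌈x i + r - y i⌉)).image F).subset ?_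
    rintro z ⟨hz, hzr⟩
    have hz' : ∀ i, ∃ n : ℤ, z i - y i = n := fun i =>
      coe_eq_coe_iff.1 (congrArg (fun w : FlatTorus d => w i) hz)
    choose n hn using hz'
    refine ⟨n, ⟨fun i => ?_, fun i => ?_⟩, ?_⟩
    · have := (abs_le.1 ((abs_sub_apply_le z x i).trans hzr)).1
      exact Int.cast_le.1 ((Int.floor_le _).trans (by rw [← hn]; linarith))
    · have := (abs_le.1 ((abs_sub_apply_le z x i).trans hzr)).2
      exact Int.cast_le.1 (le_trans (by rw [← hn]; linarith) (Int.le_ceil _))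
    · ext i
      simp [F, ← hn]
  refine (hL.biUnion fun p _ => hfib p).subset fun z hz => ?_
  exact Set.mem_biUnion hz.1 ⟨rfl, hz.2⟩

/-- A nearest site is in particular nearest among all lifts of its own projection. -/
theorem dist_proj_eq_of_mem_nearest {L : Set (FlatTorus d)} {x p : E d}
    (hp : p ∈ nearest (proj ⁻¹' L) x) : dist (proj x) (proj p) = dist x p := by
  obtain ⟨y, hy, hd⟩ := exists_lift_dist_eq x (proj p)
  refine le_antisymm (dist_proj_le x p) ?_
  rw [← hd]
  exact hp.2 y (by rw [Set.mem_preimage, hy]; exact hp.1)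

theorem proj_mem_nearest {L : Set (FlatTorus d)} {x p : E d}
    (hp : p ∈ nearest (proj ⁻¹' L) x) : proj p ∈ nearest L (proj x) := by
  refine ⟨hp.1, fun q hq => ?_⟩
  obtain ⟨y, rfl, hd⟩ := exists_lift_dist_eq x q
  rw [dist_proj_eq_of_mem_nearest hp, ← hd]
  exact hp.2 y hq

theorem exists_mem_nearest_proj_eq {L : Set (FlatTorus d)} {x : E d} {p : FlatTorus d}
    (hp : p ∈ nearest L (proj x)) : ∃ y ∈ nearest (proj ⁻¹' L) x, proj y = p := by
  obtain ⟨y, rfl, hd⟩ := exists_lift_dist_eq x p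
  refine ⟨y, ⟨hp.1, fun q hq => ?_⟩, rfl⟩
  rw [hd]
  exact (hp.2 _ hq).trans (dist_proj_le x q)

/-- A sample of the torus lifts to a sample of Euclidean space. -/
theorem IsSample.lift {L : Set (FlatTorus d)} {r : ℝ} (h : IsSample L r) (x : E d) :
    ∃ p ∈ proj ⁻¹' L, dist x p < r := by
  obtain ⟨q, hq, hlt⟩ := h (proj x)
  obtain ⟨y, rfl, hd⟩ := exists_lift_dist_eq x q
  exact ⟨y, hq, hd ▸ hlt⟩

theorem dist_lt_of_mem_nearest {X : Type*} [MetricSpace X] {P : Set X} {x p : X} {r : ℝ}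
    (hs : ∃ q ∈ P, dist x q < r) (hp : p ∈ nearest P x) : dist x p < r := by
  obtain ⟨q, hq, hlt⟩ := hs
  exact (hp.2 q hq).trans_lt hlt

theorem injOn_proj_nearest {L : Set (FlatTorus d)} {r : ℝ} (h : IsSample L r) (hr : r ≤ 1 / 2)
    (x : E d) : Set.InjOn proj (nearest (proj ⁻¹' L) x) := by
  intro p hp q hq hpq
  by_contra hne
  have h1 := one_le_dist_of_proj_eq hpq hne
  have h2 := dist_triangle_left p q x
  have h3 := dist_lt_of_mem_nearest (h.lift x) hp
  have h4 := dist_lt_of_mem_nearest (h.lift x) hq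
  linarith

theorem le_dist_of_proj {L : Set (FlatTorus d)} {m : ℝ} (hm : m ≤ 1)
    (hsep : ∀ p ∈ L, ∀ q ∈ L, p ≠ q → m ≤ dist p q) :
    ∀ p ∈ proj ⁻¹' L, ∀ q ∈ proj ⁻¹' L, p ≠ q → m ≤ dist (p : E d) q := by
  intro p hp q hq hne
  by_cases h : proj p = proj q
  · exact hm.trans (one_le_dist_of_proj_eq h hne)
  · exact (hsep _ hp _ hq h).trans (dist_proj_le p q)

/-- Protection of the top simplices of a torus Delaunay complex passes to the lift, up to the
distance between different lifts of a point. -/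
theorem protectedTops_lift {L : Set (FlatTorus d)} {r δ δ' : ℝ} (h : IsSample L r)
    (hr : r ≤ 1 / 2) (hδ : δ' ≤ δ) (hrδ : 2 * r + δ' ≤ 1)
    (hprot : ∀ σ ∈ delaunayComplex L, σ.card = d + 1 →
      ∀ c, IsDelaunayCenter L σ c → IsProtectedAt L δ σ c) :
    ProtectedTops (proj ⁻¹' L : Set (E d)) δ' := by
  classical
  intro y T hT hcard p hp q hq hqT
  rw [finrank_euclideanSpace_fin] at hcard
  have hinj : Set.InjOn proj (T : Set (E d)) := (injOn_proj_nearest h hr y).mono hT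
  have hcard' : (T.image proj).card = d + 1 := by
    rw [Finset.card_image_of_injOn hinj, hcard]
  have hsub : ((T.image proj : Finset (FlatTorus d)) : Set (FlatTorus d)) ⊆
      nearest L (proj y) := by
    rw [Finset.coe_image]
    rintro _ ⟨t, ht, rfl⟩
    exact proj_mem_nearest (hT ht)
  have hsubL : ((T.image proj : Finset (FlatTorus d)) : Set (FlatTorus d)) ⊆ L :=
    fun z hz => (hsub hz).1
  have hcen := (isDelaunayCenter_iff_subset_nearest hsubL).2 hsub
  have hp' := Finset.mem_image_of_mem proj hp
  by_cases hqi : proj q ∈ T.image proj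
  -- Here `q` is another lift of a vertex `t`; it is at distance at least 1 from `t`, hence far from
  -- `y` by `hrδ`.
  · obtain ⟨t, ht, htq⟩ := Finset.mem_image.1 hqi
    have h1 := one_le_dist_of_proj_eq htq (fun h => hqT (h ▸ ht))
    have h2 := dist_triangle_left t q y
    have h3 := dist_eq_of_mem_nearest (hT hp) (hT ht)
    have h4 := dist_lt_of_mem_nearest (h.lift y) (hT ht)
    linarith
  · have := hprot _ ⟨⟨_, hp'⟩, hsubL, _, hcen⟩ hcard' _ hcen _ hp' (proj q) ⟨hq, hqi⟩
    rw [dist_proj_eq_of_mem_nearest (hT hp)] at this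
    linarith [dist_proj_le y q]

/-! ### Perturbed nets and sparsity -/

/-- A net that is perturbed is a net. -/
theorem IsNet.image {X : Type*} [MetricSpace X] {L : Set X} {lam mu rho : ℝ} (hL : IsNet L lam mu)
    (hrho : 0 ≤ rho) {f : X → X} (hf : ∀ p ∈ L, dist (f p) p ≤ rho * lam) :
    IsNet (f '' L) (lam * (1 + rho)) ((mu - 2 * rho) / (1 + rho)) := by
  refine ⟨fun x => ?_, ?_⟩
  · obtain ⟨s, hs, hlt⟩ := hL.1 x
    refine ⟨f s, ⟨s, hs, rfl⟩, ?_⟩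
    have := dist_triangle_right x (f s) s
    linarith [hf s hs]
  · rintro _ ⟨p, hp, rfl⟩ _ ⟨q, hq, rfl⟩ hne
    have h1 := hL.2 p hp q hq fun h => hne (h ▸ rfl)
    have h2 := dist_triangle p (f p) q
    have h3 := dist_triangle (f p) (f q) q
    have h4 := hf p hp
    have h5 := hf q hq
    rw [dist_comm] at h4
    have : (mu - 2 * rho) / (1 + rho) * (lam * (1 + rho)) = (mu - 2 * rho) * lam := by
      field_simp
    rw [this]
    linarith

/-- A point at distance exactly `lam` from one net point needs another within `lam`; the two net
points are then closer than `2 * lam`. -/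
theorem IsNet.sparsity_lt_two (hd : 1 ≤ d) {L : Set (FlatTorus d)} {lam mu : ℝ}
    (hL : IsNet L lam mu) (hlam : lam ≤ 1 / 2) : 0 < lam ∧ mu < 2 := by
  obtain ⟨p, hp, hlt⟩ := hL.1 (proj 0)
  have h0 : 0 < lam := dist_nonneg.trans_lt hlt
  refine ⟨h0, ?_⟩
  obtain ⟨x, rfl⟩ := proj_surjective p
  let v : E d := EuclideanSpace.single ⟨0, hd⟩ lam
  have hv : dist (x + v) x = lam := by
    rw [dist_self_add_left, PiLp.norm_single, Real.norm_of_nonneg h0.le]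
  have hv' : dist (proj (x + v)) (proj x) = lam := by
    rw [dist_proj_eq_of_dist_le (by rw [hv]; linarith), hv]
  obtain ⟨q, hq, hql⟩ := hL.1 (proj (x + v))
  have hne : proj x ≠ q := fun h => by
    rw [← h, hv'] at hql
    exact lt_irrefl _ hql
  have h1 := hL.2 _ hp _ hq hne
  have h2 := dist_triangle_left (proj x) q (proj (x + v))
  nlinarith

/-! ### Volumes, packing and full cells -/

/-- The half-open cube with lower corner `a` and side length `r`. -/
def halfOpenCube (a : E d) (r : ℝ) : Set (E d) := {x | ∀ i, a i ≤ x i ∧ x i < a i + r}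

theorem halfOpenCube_subset_cube (a : E d) (r : ℝ) : halfOpenCube a r ⊆ cube a r :=
  fun _ hx i => ⟨(hx i).1, (hx i).2.le⟩

theorem halfOpenCube_eq_preimage (a : E d) (r : ℝ) :
    halfOpenCube a r = (@WithLp.ofLp 2 (Fin d → ℝ)) ⁻¹'
      Set.pi Set.univ fun i => Set.Ico (a i) (a i + r) := by
  ext x
  simp [halfOpenCube]

theorem measurableSet_halfOpenCube (a : E d) (r : ℝ) : MeasurableSet (halfOpenCube a r) := by
  rw [halfOpenCube_eq_preimage]
  exact (PiLp.volume_preserving_ofLp (Fin d)).measurable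
    (MeasurableSet.univ_pi fun i => measurableSet_Ico)

theorem volume_halfOpenCube (a : E d) (r : ℝ) :
    volume (halfOpenCube a r) = ENNReal.ofReal r ^ d := by
  rw [halfOpenCube_eq_preimage, (PiLp.volume_preserving_ofLp (Fin d)).measure_preimage
    (MeasurableSet.univ_pi fun i => measurableSet_Ico).nullMeasurableSet, Real.volume_pi_Ico]
  simp

theorem volume_closedBall_eq (y : E d) {s : ℝ} (hs : 0 ≤ s) :
    volume (Metric.closedBall y s) = ENNReal.ofReal (unitBallVolume d * s ^ d) := by
  rw [Measure.addHaar_closedBall _ _ hs, finrank_euclideanSpace_fin, unitBallVolume, mul_comm,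
    ENNReal.ofReal_mul ENNReal.toReal_nonneg,
    ENNReal.ofReal_toReal measure_ball_lt_top.ne]

/-- Packing bound: the number of cells of a cubical grid inside a ball. -/
theorem ncard_mul_pow_le {M : ℕ} (a y : E d) {r s : ℝ} (hr : 0 < r) (hs : 0 ≤ s)
    (J : Set (Fin d → Fin M))
    (hJ : ∀ j ∈ J, cube (WithLp.toLp 2 fun i => a i + (j i : ℕ) * r) r ⊆ Metric.closedBall y s) :
    (J.ncard : ℝ) * r ^ d ≤ unitBallVolume d * s ^ d := by
  classical
  set c : (Fin d → Fin M) → E d := fun j => WithLp.toLp 2 fun i => a i + (j i : ℕ) * r with hc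
  have hdisj : (J.toFinite.toFinset : Set (Fin d → Fin M)).PairwiseDisjoint
      fun j => halfOpenCube (c j) r := by
    intro j _ k _ hjk
    refine Set.disjoint_left.2 fun x hx hx' => hjk ?_
    ext i
    have h1 := hx i
    have h2 := hx' i
    simp only [hc] at h1 h2
    have h3 : ((j i : ℕ) : ℝ) < (k i : ℕ) + 1 := by
      by_contra! h
      nlinarith [mul_le_mul_of_nonneg_right h hr.le]
    have h4 : ((k i : ℕ) : ℝ) < (j i : ℕ) + 1 := by
      by_contra! h
      nlinarith [mul_le_mul_of_nonneg_right h hr.le]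
    norm_cast at h3 h4
    omega
  have hsub : ⋃ j ∈ J.toFinite.toFinset, halfOpenCube (c j) r ⊆ Metric.closedBall y s := by
    refine Set.iUnion₂_subset fun j hj => (halfOpenCube_subset_cube _ _).trans (hJ j ?_)
    simpa using hj
  have h := measure_mono (μ := volume) hsub
  rw [measure_biUnion_finset hdisj fun j _ => measurableSet_halfOpenCube _ _,
    volume_closedBall_eq y hs] at h
  simp only [volume_halfOpenCube, Finset.sum_const, nsmul_eq_mul] at h
  rw [← Set.ncard_eq_toFinset_card J, ← ENNReal.ofReal_natCast, ← ENNReal.ofReal_pow hr.le,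
    ← ENNReal.ofReal_mul (Nat.cast_nonneg _)] at h
  exact (ENNReal.ofReal_le_ofReal_iff (mul_nonneg ENNReal.toReal_nonneg (pow_nonneg hs d))).1 h

/-- The unit ball contains the cube with half-diagonal `1`. -/
theorem two_pow_le_unitBallVolume_mul (d : ℕ) :
    (2 : ℝ) ^ d ≤ unitBallVolume d * √(d : ℝ) ^ d := by
  -- The packing bound is applied to the single cell `[-1, 1]^d` in the ball of radius `√d`.
  have h := ncard_mul_pow_le (d := d) (M := 1) (WithLp.toLp 2 fun _ => -1) 0 (r := 2)
    (s := √(d : ℝ)) two_pos (Real.sqrt_nonneg _) Set.univ (by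
      intro j _ x hx
      rw [mem_closedBall_zero_iff, EuclideanSpace.norm_eq]
      refine Real.sqrt_le_sqrt ?_
      calc ∑ i, ‖x i‖ ^ 2 ≤ ∑ _i : Fin d, (1 : ℝ) := by
            refine Finset.sum_le_sum fun i _ => ?_
            have := hx i
            simp only [Fin.val_eq_zero, Nat.cast_zero, zero_mul, add_zero] at this
            rw [Real.norm_eq_abs, sq_abs]
            nlinarith
        _ = d := by simp)
  simpa [Set.ncard_univ] using h

theorem dist_le_sqrt_mul {x y : E d} {r : ℝ} (hr : 0 ≤ r) (h : ∀ i, |x i - y i| ≤ r) :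
    dist x y ≤ √(d : ℝ) * r := by
  rw [EuclideanSpace.dist_eq, ← Real.sqrt_sq hr, ← Real.sqrt_mul (Nat.cast_nonneg d)]
  refine Real.sqrt_le_sqrt ?_
  calc ∑ i, dist (x i) (y i) ^ 2 ≤ ∑ _i : Fin d, r ^ 2 := by
        refine Finset.sum_le_sum fun i _ => ?_
        rw [Real.dist_eq]
        exact pow_le_pow_left₀ (abs_nonneg _) (h i) 2
    _ = d * r ^ 2 := by simp

theorem dist_le_of_mem_cube {a x y : E d} {r : ℝ} (hr : 0 ≤ r) (hx : x ∈ cube a r)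
    (hy : y ∈ cube a r) : dist x y ≤ √(d : ℝ) * r := by
  refine dist_le_sqrt_mul hr fun i => abs_le.2 ⟨?_, ?_⟩
  · linarith [(hx i).1, (hy i).2]
  · linarith [(hx i).2, (hy i).1]

/-- A point of a full cell is nearly on all the bisectors. -/
theorem IsFull.abs_inner_le {s : Finset (E d)} {a : E d} {r : ℝ} (hr : 0 ≤ r)
    (hfull : IsFull s (cube a r)) {x c : E d} (hx : x ∈ cube a r) {p q : E d} (hp : p ∈ s)
    (hq : q ∈ s) (hpq : p ≠ q) (hc : dist c p = dist c q) :
    |inner ℝ (x - c) (p - q)| ≤ √(d : ℝ) * r * dist p q := by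
  obtain ⟨z, hz, hzpq⟩ := hfull p hp q hq hpq
  -- Since `z` and `c` lie on the same bisector, `z - c` is orthogonal to `p - q`, and only `x - z`
  -- contributes.
  have h := dist_add_smul_sq_sub c (z - c) p q 1
  rw [one_smul, add_sub_cancel, hzpq, hc] at h
  have h0 : inner ℝ (z - c) (p - q) = 0 := by linarith
  have : inner ℝ (x - c) (p - q) = inner ℝ (x - z) (p - q) := by
    rw [show x - c = (x - z) + (z - c) by abel, inner_add_left, h0, add_zero]
  rw [this]
  refine (abs_real_inner_le_norm _ _).trans ?_
  rw [← dist_eq_norm, ← dist_eq_norm]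
  exact mul_le_mul_of_nonneg_right (dist_le_of_mem_cube hr hx hz) dist_nonneg

/-- If `c` is close to all points of `s`, it is close to the center of the bounding box. -/
theorem abs_sub_boxCenter_le {s : Finset (E d)} (hs : s.Nonempty) {c : E d} {R : ℝ}
    (h : ∀ p ∈ s, dist c p ≤ R) (i : Fin d) : |c i - boxCenter s i| ≤ R := by
  have hne : ((fun p : E d => p i) '' (s : Set (E d))).Nonempty := hs.to_set.image _
  have hfin : ((fun p : E d => p i) '' (s : Set (E d))).Finite := s.finite_toSet.image _
  obtain ⟨p, hp, hpi⟩ := hne.csInf_mem hfin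
  obtain ⟨q, hq, hqi⟩ := hne.csSup_mem hfin
  have h1 := abs_le.1 ((abs_sub_apply_le c p i).trans (h p hp))
  have h2 := abs_le.1 ((abs_sub_apply_le c q i).trans (h q hq))
  simp only [boxCenter, ← hpi, ← hqi]
  exact abs_le.2 ⟨by linarith [h1.1, h2.1], by linarith [h1.2, h2.2]⟩

/-! ### Geometry and size of the pyramid -/

namespace WitnessGrid

variable (G : WitnessGrid d) (lam α : ℝ) (s : Finset (E d))

theorem N_cast_pos : (0 : ℝ) < G.N := Nat.cast_pos.2 G.N_pos

theorem rootCorner_le (i : Fin d) : G.rootCorner lam α s i ≤ omegaCorner lam α s i := by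
  have hN := G.N_cast_pos
  have h := Int.floor_le ((omegaCorner lam α s i - G.origin i) * G.N)
  have h' := (div_le_iff₀ hN).2 h
  simp only [rootCorner]
  linarith

theorem lt_rootCorner_add (i : Fin d) :
    omegaCorner lam α s i < G.rootCorner lam α s i + 1 / G.N := by
  have hN := G.N_cast_pos
  have h := Int.lt_floor_add_one ((omegaCorner lam α s i - G.origin i) * G.N)
  have h' := (lt_div_iff₀ hN).2 h
  simp only [rootCorner]
  rw [add_div] at h'
  linarith

theorem cube_omegaCorner_subset {h : ℕ} (hh : (4 * lam + 4 * α) * G.N + 1 ≤ 2 ^ h) :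
    cube (omegaCorner lam α s) (4 * lam + 4 * α) ⊆
      cube (G.rootCorner lam α s) (2 ^ h / G.N) := by
  have hN := G.N_cast_pos
  intro x hx i
  refine ⟨(G.rootCorner_le lam α s i).trans (hx i).1, ?_⟩
  have h1 := (hx i).2
  have h2 := G.lt_rootCorner_add lam α s i
  have h3 : 4 * lam + 4 * α + 1 / G.N ≤ 2 ^ h / G.N := by
    rw [le_div_iff₀ hN, add_mul, div_mul_cancel₀ _ hN.ne']
    exact hh
  linarith

theorem cube_omegaCorner_subset_root :
    cube (omegaCorner lam α s) (4 * lam + 4 * α) ⊆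
      cube (G.rootCorner lam α s) (G.rootSide lam α s) := by
  obtain ⟨h, hh⟩ := pow_unbounded_of_one_lt ((4 * lam + 4 * α) * G.N + 1) (one_lt_two (α := ℝ))
  exact Nat.sInf_mem (s := {h : ℕ | cube (omegaCorner lam α s) (4 * lam + 4 * α) ⊆
    cube (G.rootCorner lam α s) (2 ^ h / G.N)}) ⟨h, G.cube_omegaCorner_subset lam α s hh.le⟩

/-- By minimality of the depth, the block one level smaller misses part of the cube; the `+ 1` pays
for rounding the corner down to the grid. -/
theorem two_pow_depth_le (hS : 0 ≤ 4 * lam + 4 * α) :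
    (2 : ℝ) ^ G.depth lam α s ≤ 2 * ((4 * lam + 4 * α) * G.N + 1) := by
  have hSN : 0 ≤ (4 * lam + 4 * α) * G.N := mul_nonneg hS G.N_cast_pos.le
  rcases hH : G.depth lam α s with _ | k
  · rw [pow_zero]
    linarith
  · have hk : k < G.depth lam α s := by omega
    have : ¬ (4 * lam + 4 * α) * G.N + 1 ≤ 2 ^ k := fun hle =>
      Nat.notMem_of_lt_sInf hk (G.cube_omegaCorner_subset lam α s hle)
    rw [pow_succ]
    linarith [not_le.1 this]

theorem rootSide_pos : 0 < G.rootSide lam α s := div_pos (by positivity) G.N_cast_pos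

theorem rootSide_div : G.rootSide lam α s / 2 ^ G.depth lam α s = 1 / G.N := by
  rw [rootSide, div_div, mul_comm, ← div_div, div_self (by positivity)]

/-- The point `c` lies in a grid cell of the pyramid, whose center is a witness. -/
theorem exists_leaf {c : E d} (hc : ∀ i, omegaCorner lam α s i ≤ c i ∧
    c i < omegaCorner lam α s i + (4 * lam + 4 * α)) :
    ∃ j : Fin d → Fin (2 ^ G.depth lam α s),
      c ∈ cube (cellCorner (G.rootCorner lam α s) (G.rootSide lam α s) (G.depth lam α s) j)
        (G.rootSide lam α s / 2 ^ G.depth lam α s) ∧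
      proj (cubeCenter (cellCorner (G.rootCorner lam α s) (G.rootSide lam α s)
        (G.depth lam α s) j) (G.rootSide lam α s / 2 ^ G.depth lam α s)) ∈ G.witnesses := by
  have hN := G.N_cast_pos
  rw [G.rootSide_div lam α s]
  set H := G.depth lam α s with hH
  set a := G.rootCorner lam α s with ha
  have hlow : ∀ i, 0 ≤ (c i - a i) * G.N := fun i =>
    mul_nonneg (by linarith [G.rootCorner_le lam α s i, (hc i).1]) hN.le
  have htop : ∀ i, (c i - a i) * G.N < 2 ^ H := by
    intro i
    rcases lt_or_ge (4 * lam + 4 * α) 0 with hneg | hpos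
    · linarith [(hc i).1, (hc i).2]
    have := (G.cube_omegaCorner_subset_root lam α s
      (show (WithLp.toLp 2 fun i => omegaCorner lam α s i + (4 * lam + 4 * α) : E d) ∈ _ from
        fun i => ⟨by simpa using hpos, le_rfl⟩) i).2
    rw [← lt_div_iff₀ hN]
    have h2 : G.rootSide lam α s = 2 ^ H / G.N := rfl
    rw [h2] at this
    have h3 := (hc i).2
    simp only at this
    linarith
  have hj : ∀ i, ⌊(c i - a i) * G.N⌋₊ < 2 ^ H := fun i => by
    rw [Nat.floor_lt (hlow i)]
    push_cast
    exact htop i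
  refine ⟨fun i => ⟨⌊(c i - a i) * G.N⌋₊, hj i⟩, fun i => ?_, ?_⟩
  · simp only [cellCorner]
    rw [G.rootSide_div lam α s]
    have h1 := Nat.floor_le (hlow i)
    have h2 := Nat.lt_floor_add_one ((c i - a i) * G.N)
    have h1' := (div_le_iff₀ hN).2 h1
    have h2' := (lt_div_iff₀ hN).2 h2
    rw [add_div] at h2'
    rw [mul_one_div]
    constructor <;> linarith
  · refine ⟨fun i => ⌊(omegaCorner lam α s i - G.origin i) * G.N⌋ +
      (⌊(c i - a i) * G.N⌋₊ : ℤ), ?_⟩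
    refine congrArg proj ?_
    ext i
    simp only [cubeCenter, cellCorner]
    rw [G.rootSide_div lam α s]
    simp only [ha, rootCorner]
    push_cast
    ring

theorem ncard_level_le (h : ℕ) (Q : (Fin d → Fin (2 ^ h)) → Prop) :
    Set.ncard {j | Q j} ≤ (2 ^ h) ^ d := by
  refine (Set.ncard_le_ncard (Set.subset_univ _)).trans_eq ?_
  rw [Set.ncard_univ, Nat.card_eq_fintype_card]
  simp

/-- If the full cells of each level are bounded by `B`, then a few levels at the top, which have
few cells, compensate for the rounding in the number of levels. -/
theorem numFullCells_le {B X : ℝ}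
    (hB : ∀ h, (Set.ncard {j : Fin d → Fin (2 ^ h) | G.IsFullCell lam α s h j} : ℝ) ≤ B)
    (hB8 : 4 * 8 ^ d ≤ B) (hX : 2 ≤ X) (hdepth : (2 : ℝ) ^ (G.depth lam α s + 1) ≤ 8 * X) :
    (G.numFullCells lam α s : ℝ) ≤ B * Real.logb 2 X := by
  have hB0 : 0 ≤ B := le_trans (by positivity) hB8
  have hlog : 1 ≤ Real.logb 2 X := by
    rw [Real.le_logb_iff_rpow_le one_lt_two (by linarith), Real.rpow_one]
    exact hX
  -- There may be 3 levels more than `logb 2 X`. The first four levels have at most `8 ^ d` cells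
  -- each, so together they cost at most one `B`.
  have hlog' : (G.depth lam α s + 1 : ℕ) ≤ 3 + Real.logb 2 X := by
    have h8 : Real.logb 2 8 = 3 := by
      rw [show (8 : ℝ) = 2 ^ (3 : ℝ) by norm_num, Real.logb_rpow two_pos (by norm_num)]
    rw [← h8, ← Real.logb_mul (by norm_num) (by linarith), Real.le_logb_iff_rpow_le one_lt_two
      (by linarith), Real.rpow_natCast]
    exact hdepth
  set n := G.depth lam α s + 1 with hn
  have hsmall : ∀ h ∈ Finset.range (min n 4),
      (Set.ncard {j : Fin d → Fin (2 ^ h) | G.IsFullCell lam α s h j} : ℝ) ≤ 8 ^ d := by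
    intro h hh
    have h3 : h ≤ 3 := by
      have := Finset.mem_range.1 hh
      omega
    have h1 : (Set.ncard {j : Fin d → Fin (2 ^ h) | G.IsFullCell lam α s h j} : ℝ) ≤
        ((2 ^ h) ^ d : ℕ) := Nat.cast_le.2 (ncard_level_le h _)
    refine h1.trans ?_
    push_cast
    have h2 : (2 : ℝ) ^ h ≤ 8 := by
      calc (2 : ℝ) ^ h ≤ 2 ^ 3 := pow_le_pow_right₀ one_le_two h3
        _ = 8 := by norm_num
    exact pow_le_pow_left₀ (by positivity) h2 d
  have hsum : (G.numFullCells lam α s : ℝ) ≤ (min n 4 : ℕ) * 8 ^ d + ((n - min n 4 : ℕ) : ℝ) * B := by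
    rw [numFullCells, ← hn, Nat.cast_sum, ← Finset.sum_range_add_sum_Ico _ (min_le_left n 4)]
    refine add_le_add ?_ ?_
    · refine (Finset.sum_le_card_nsmul _ _ _ hsmall).trans_eq ?_
      rw [Finset.card_range, nsmul_eq_mul]
    · refine (Finset.sum_le_card_nsmul _ _ _ fun h _ => hB h).trans_eq ?_
      rw [Nat.card_Ico, nsmul_eq_mul]
  refine hsum.trans ?_
  have hmin : ∀ k : ℕ, k ≤ 4 → (k : ℝ) * 8 ^ d ≤ B := fun k hk =>
    (mul_le_mul_of_nonneg_right (by exact_mod_cast hk) (by positivity)).trans hB8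
  rcases le_total n 4 with h4 | h4
  · rw [min_eq_left h4, Nat.sub_self, Nat.cast_zero, zero_mul, add_zero]
    exact (hmin n h4).trans (le_mul_of_one_le_right hB0 hlog)
  · rw [min_eq_right h4, Nat.cast_sub h4, Nat.cast_ofNat]
    have : (1 + ((n : ℝ) - 4)) * B ≤ Real.logb 2 X * B :=
      mul_le_mul_of_nonneg_right (by linarith) hB0
    have := hmin 4 le_rfl
    push_cast at this ⊢
    linarith

end WitnessGrid

theorem WitnessGrid.eps_pos (hd : 1 ≤ d) (G : WitnessGrid d) : 0 < G.eps :=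
  div_pos (Real.sqrt_pos.2 (Nat.cast_pos.2 hd)) G.N_cast_pos

/-! ### Counting the full cells of a protected simplex -/

/-- All cells that are full for a protected top simplex are close to its circumcenter. -/
theorem cube_subset_closedBall_of_isFull {L : Set (FlatTorus d)} (hfin : L.Finite)
    {lam mu δ δbar Θ₀ : ℝ} (hlam : lam ≤ 3 / 8) (hmu : 0 < mu) (hmu2 : mu ≤ 2)
    (hnet : IsNet L lam mu) (hδ : δ = δbar * lam) (hδbar : 0 < δbar) (hδlam : δ ≤ lam)
    (hprot : ∀ σ ∈ delaunayComplex L, σ.card = d + 1 →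
      ∀ c, IsDelaunayCenter L σ c → IsProtectedAt L δ σ c)
    (hΘ₀ : 0 < Θ₀) (hΘ₀_le : 12 * d * Θ₀ ≤ δbar)
    {c : E d} {T : Finset (E d)} (hT : (T : Set (E d)) = nearest (proj ⁻¹' L) c)
    (hcard : T.card = d + 1)
    (hspan : ∀ v : E d, (∀ p ∈ T, ∀ q ∈ T, inner ℝ v (p - q) = 0) → v = 0)
    {a : E d} {r : ℝ} (hr : 0 ≤ r) (hfull : IsFull T (cube a r)) :
    cube a r ⊆ Metric.closedBall c (4 * d / (Θ₀ * mu) * r) := by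
  intro x hx
  obtain ⟨p, -, hp⟩ := hnet.1 (proj 0)
  have hlam0 : 0 < lam := dist_nonneg.trans_lt hp
  have hδ0 : 0 < δ / 2 := by
    rw [hδ]
    positivity
  -- Protection is halved because `2 * lam + δ` may exceed 1 when `lam ≤ 3 / 8`, while `2 * lam + δ
  -- / 2` cannot.
  have hdist := dist_circumcenter_le (P := proj ⁻¹' L) (Λ := lam) (δ := δ / 2) (m := mu * lam)
    (κ := √(d : ℝ) * r) hδ0 (mul_pos hmu hlam0) (by positivity)
    (finite_preimage_proj_inter_closedBall hfin) hnet.1.lift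
    (protectedTops_lift hnet.1 (by linarith) (by linarith) (by linarith) hprot)
    (le_dist_of_proj (by nlinarith) hnet.2) (x := x) hT
    (by rw [hcard, finrank_euclideanSpace_fin]) hspan
    (fun p hp q hq hpq => hfull.abs_inner_le hr hx hp hq hpq
      (dist_eq_of_mem_nearest (P := proj ⁻¹' L) (hT ▸ Finset.mem_coe.2 hp)
        (hT ▸ Finset.mem_coe.2 hq)))
  rw [finrank_euclideanSpace_fin] at hdist
  refine hdist.trans ?_
  have e : (d : ℝ) * (4 * lam / (mu * lam * (δ / 2)) * (√(d : ℝ) * r * (2 * lam))) =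
      4 * d / (Θ₀ * mu) * r * (4 * √(d : ℝ) * Θ₀ / δbar) := by
    rw [hδ]
    field_simp
    ring
  rw [e]
  refine mul_le_of_le_one_right (by positivity) ?_
  rw [div_le_one hδbar]
  have hsqrt : √(d : ℝ) ≤ d := by
    rcases Nat.eq_zero_or_pos d with h | h
    · simp [h]
    · rw [Real.sqrt_le_left (Nat.cast_nonneg d)]
      have : (1 : ℝ) ≤ d := Nat.one_le_cast.2 h
      nlinarith
  have h1 : √(d : ℝ) * Θ₀ ≤ d * Θ₀ := mul_le_mul_of_nonneg_right hsqrt hΘ₀.le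
  have h2 : 0 ≤ d * Θ₀ := by positivity
  linarith

/-- This makes the bound per level large enough to pay for the four top levels. -/
theorem four_mul_eight_pow_le (hd : 1 ≤ d) {K : ℝ} (hK : 24 * √(d : ℝ) ≤ K) :
    4 * 8 ^ d ≤ unitBallVolume d * K ^ d := by
  have hU : 0 ≤ unitBallVolume d := ENNReal.toReal_nonneg
  calc (4 : ℝ) * 8 ^ d ≤ 6 ^ d * 8 ^ d := by
        refine mul_le_mul_of_nonneg_right ?_ (by positivity)
        calc (4 : ℝ) ≤ 6 ^ 1 := by norm_num
          _ ≤ 6 ^ d := pow_le_pow_right₀ (by norm_num) hd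
    _ = 24 ^ d * 2 ^ d := by rw [← mul_pow, ← mul_pow]; norm_num
    _ ≤ 24 ^ d * (unitBallVolume d * √(d : ℝ) ^ d) :=
        mul_le_mul_of_nonneg_left (two_pow_le_unitBallVolume_mul d) (by positivity)
    _ = unitBallVolume d * (24 * √(d : ℝ)) ^ d := by rw [mul_pow]; ring
    _ ≤ unitBallVolume d * K ^ d :=
        mul_le_mul_of_nonneg_left (pow_le_pow_left₀ (by positivity) hK d) hU

/-- The pyramid of a protected top simplex has few full cells. -/
theorem numFullCells_le_fullCellBound (hd : 1 ≤ d) {L : Set (FlatTorus d)} (hfin : L.Finite)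
    {lam mu δ δbar Θ₀ : ℝ} (hlam : lam ≤ 3 / 8) (hmu : 0 < mu) (hmu2 : mu ≤ 2)
    (hnet : IsNet L lam mu) (G : WitnessGrid d) (hδ : δ = δbar * lam) (hδbar : 0 < δbar)
    (hδε : 8 * G.eps + δ ≤ lam)
    (hprot : ∀ σ ∈ delaunayComplex L, σ.card = d + 1 →
      ∀ c, IsDelaunayCenter L σ c → IsProtectedAt L δ σ c)
    (hΘ₀ : 0 < Θ₀) (hΘ₀_le : 12 * d * Θ₀ ≤ δbar)
    {c : E d} {T : Finset (E d)} (hT : (T : Set (E d)) = nearest (proj ⁻¹' L) c)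
    (hcard : T.card = d + 1)
    (hspan : ∀ v : E d, (∀ p ∈ T, ∀ q ∈ T, inner ℝ v (p - q) = 0) → v = 0) :
    (G.numFullCells lam (2 * G.eps) T : ℝ) ≤ fullCellBound d lam mu G.eps Θ₀ := by
  have hε := G.eps_pos hd
  have hN := G.N_cast_pos
  obtain ⟨p, -, hp⟩ := hnet.1 (proj 0)
  have hlam0 : 0 < lam := dist_nonneg.trans_lt hp
  have hd1 : (1 : ℝ) ≤ d := Nat.one_le_cast.2 hd
  have hsq1 : 1 ≤ √(d : ℝ) := Real.one_le_sqrt.2 hd1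
  have hδ0 : 0 < δ := by
    rw [hδ]
    positivity
  have hδbar1 : δbar ≤ 1 := by
    have : δbar * lam ≤ 1 * lam := by linarith
    exact le_of_mul_le_mul_right this hlam0
  have hεN : G.eps * G.N = √(d : ℝ) := div_mul_cancel₀ _ hN.ne'
  have hX : 5 * √(d : ℝ) * lam / G.eps = 5 * lam * G.N := by
    rw [div_eq_iff hε.ne', mul_assoc (5 * lam), mul_comm (G.N : ℝ), hεN]
    ring
  have hlamN : 8 * √(d : ℝ) ≤ lam * G.N := by
    rw [← hεN, ← mul_assoc]
    exact mul_le_mul_of_nonneg_right (by linarith) hN.le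
  refine G.numFullCells_le lam (2 * G.eps) T (fun h => ?_)
    (four_mul_eight_pow_le hd ?_) ?_ ?_
  · have hr : 0 < G.rootSide lam (2 * G.eps) T / 2 ^ h :=
      div_pos (G.rootSide_pos _ _ _) (by positivity)
    have := ncard_mul_pow_le (G.rootCorner lam (2 * G.eps) T) c hr
      (s := 4 * d / (Θ₀ * mu) * (G.rootSide lam (2 * G.eps) T / 2 ^ h)) (by positivity)
      {j : Fin d → Fin (2 ^ h) | G.IsFullCell lam (2 * G.eps) T h j}
      fun j hj => cube_subset_closedBall_of_isFull hfin hlam hmu hmu2 hnet hδ hδbar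
        (by linarith) hprot hΘ₀ hΘ₀_le hT hcard hspan hr.le hj
    rw [mul_pow, ← mul_assoc] at this
    exact le_of_mul_le_mul_right this (by positivity)
  · rw [le_div_iff₀ (by positivity)]
    have hsqd : √(d : ℝ) ≤ d := by
      rw [Real.sqrt_le_left (Nat.cast_nonneg d)]
      nlinarith
    have h1 : 12 * d * Θ₀ * mu ≤ 1 * 2 :=
      mul_le_mul (hΘ₀_le.trans hδbar1) hmu2 hmu.le zero_le_one
    have h2 : √(d : ℝ) * (Θ₀ * mu) ≤ d * (Θ₀ * mu) :=
      mul_le_mul_of_nonneg_right hsqd (by positivity)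
    linarith
  · rw [hX]
    linarith
  · rw [hX, pow_succ]
    have h1 := G.two_pow_depth_le lam (2 * G.eps) T (by positivity)
    have h2 : (4 * lam + 4 * (2 * G.eps)) * G.N ≤ 5 * lam * G.N :=
      mul_le_mul_of_nonneg_right (by linarith) hN.le
    linarith

/-! ### The two inclusions -/

theorem delaunayComplex_subset_keptComplex (hd : 1 ≤ d) {L : Set (FlatTorus d)} (hfin : L.Finite)
    {lam mu δ δbar Θ₀ : ℝ} (hlam : lam ≤ 3 / 8) (hmu : 0 < mu) (hmu2 : mu ≤ 2)
    (hnet : IsNet L lam mu) (G : WitnessGrid d) (hδ : δ = δbar * lam) (hδbar : 0 < δbar)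
    (hδε : 8 * G.eps + δ ≤ lam)
    (hprot : ∀ σ ∈ delaunayComplex L, σ.card = d + 1 →
      ∀ c, IsDelaunayCenter L σ c → IsProtectedAt L δ σ c)
    (hΘ₀ : 0 < Θ₀) (hΘ₀_le : 12 * d * Θ₀ ≤ δbar) :
    delaunayComplex L ⊆ keptComplex L G lam mu Θ₀ := by
  classical
  rintro σ ⟨⟨p₀, hp₀⟩, hσL, x, hx⟩
  have hε := G.eps_pos hd
  obtain ⟨q, -, hq⟩ := hnet.1 (proj 0)
  have hlam0 : 0 < lam := dist_nonneg.trans_lt hq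
  have hδ0 : 0 < δ := by
    rw [hδ]
    positivity
  rw [isDelaunayCenter_iff_subset_nearest hσL] at hx
  obtain ⟨x, rfl⟩ := proj_surjective x
  set P : Set (E d) := proj ⁻¹' L with hP
  have hPfin := finite_preimage_proj_inter_closedBall (d := d) hfin
  have hPprot : ProtectedTops P (δ / 2) :=
    protectedTops_lift hnet.1 (by linarith) (by linarith) (by linarith) hprot
  obtain ⟨c, hc, hspan⟩ := exists_subset_nearest_spanning (P := P)
    (σ := {y | y ∈ nearest P x ∧ proj y ∈ σ}) hPfin hnet.1.lift
    (by
      obtain ⟨y, hy, rfl⟩ := exists_mem_nearest_proj_eq (hx hp₀)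
      exact ⟨y, hy, hp₀⟩) (fun y hy => hy.1)
  obtain ⟨y₀, hy₀, rfl⟩ := exists_mem_nearest_proj_eq (hx hp₀)
  obtain ⟨T, hT, hcard⟩ := exists_finset_nearest (half_pos hδ0) hPfin hnet.1.lift hPprot
    ⟨y₀, hc ⟨hy₀, hp₀⟩⟩ hspan
  rw [finrank_euclideanSpace_fin] at hcard
  have hTn : ∀ p ∈ T, p ∈ nearest P c := fun p hp => hT ▸ Finset.mem_coe.2 hp
  have hTlt : ∀ p ∈ T, dist c p < lam := fun p hp =>
    dist_lt_of_mem_nearest (hnet.1.lift c) (hTn p hp)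
  have hinj : Set.InjOn proj (T : Set (E d)) :=
    hT ▸ injOn_proj_nearest hnet.1 (by linarith) c
  have hTne : T.Nonempty := Finset.card_pos.1 (by omega)
  have hspanT : ∀ v : E d, (∀ p ∈ T, ∀ q ∈ T, inner ℝ v (p - q) = 0) → v = 0 := fun v hv =>
    hspan v fun p hp q hq => hv p (by rwa [← Finset.mem_coe, hT]) q (by rwa [← Finset.mem_coe, hT])
  refine ⟨⟨_, hp₀⟩, T.image proj, ⟨?_, ?_, ?_, T, ?_, ?_, ?_⟩, ?_⟩
  · rw [Finset.coe_image]
    rintro _ ⟨p, hp, rfl⟩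
    exact (hTn p hp).1
  · rw [Finset.card_image_of_injOn hinj, hcard]
  · obtain ⟨p, hp⟩ := hTne
    refine ⟨proj p, Finset.mem_image_of_mem _ hp, fun q hq => ?_⟩
    obtain ⟨q, hqT, rfl⟩ := Finset.mem_image.1 hq
    rw [Metric.mem_closedBall]
    have h1 := dist_proj_le q p
    have h2 := dist_triangle_left q p c
    linarith [hTlt p hp, hTlt q hqT]
  · rw [Finset.coe_image]
    exact hinj.bijOn_image
  · have hbox := abs_sub_boxCenter_le hTne fun p hp => (hTlt p hp).le
    -- All vertices are within `lam` of `c`, so `c` is within `lam` of the box center in each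
    -- coordinate, well inside the cube.
    obtain ⟨j, hj, hw⟩ := G.exists_leaf lam (2 * G.eps) T (c := c) fun i => by
      have := abs_le.1 (hbox i)
      simp only [omegaCorner]
      constructor <;> linarith
    set a := cellCorner (G.rootCorner lam (2 * G.eps) T) (G.rootSide lam (2 * G.eps) T)
      (G.depth lam (2 * G.eps) T) j with ha
    set w := cubeCenter a
      (G.rootSide lam (2 * G.eps) T / 2 ^ G.depth lam (2 * G.eps) T) with hwdef
    have hwc : dist w c ≤ G.eps := by
      have hside : 0 ≤ G.rootSide lam (2 * G.eps) T / 2 ^ G.depth lam (2 * G.eps) T :=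
        div_nonneg (G.rootSide_pos _ _ _).le (by positivity)
      have hwmem : w ∈ cube a
          (G.rootSide lam (2 * G.eps) T / 2 ^ G.depth lam (2 * G.eps) T) := by
        intro i
        simp only [hwdef, cubeCenter]
        constructor <;> linarith
      refine (dist_le_of_mem_cube hside hwmem hj).trans_eq ?_
      rw [G.rootSide_div, mul_one_div]
      rfl
    have hwp : ∀ p ∈ T, dist w p ≤ dist c p + G.eps := fun p _ => by
      linarith [dist_triangle w c p]
    refine ⟨w, ⟨hw, j, fun p hp q hq _ => ⟨c, hj, dist_eq_of_mem_nearest (hTn p hp) (hTn q hq)⟩,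
      rfl⟩, fun p hp => ?_, fun p hp q hq => ?_⟩
    · refine (dist_proj_eq_of_dist_le ?_).symm
      linarith [hwp p hp, hTlt p hp]
    -- One `ε` is lost passing from `w` to `c` on the side of `p`, another on the side of `q`.
    · obtain ⟨p, hpT, rfl⟩ := Finset.mem_image.1 hp
      obtain ⟨q, rfl, hwq⟩ := exists_lift_dist_eq w q
      rw [← hwq]
      have h1 := dist_proj_le w p
      have h2 := (hTn p hpT).2 q hq
      have h3 := dist_triangle_left c q w
      linarith [hwp p hpT]
  · exact numFullCells_le_fullCellBound hd hfin hlam hmu hmu2 hnet G hδ hδbar hδε hprot hΘ₀ hΘ₀_le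
      hT hcard hspanT
  · intro p hp
    obtain ⟨y, hy, rfl⟩ := exists_mem_nearest_proj_eq (hx hp)
    have : y ∈ (T : Set (E d)) := by
      rw [hT]
      exact hc ⟨hy, hp⟩
    exact Finset.mem_image_of_mem _ this

/-- A kept simplex that is protected at a point equidistant from its vertices is Delaunay. -/
theorem keptComplex_subset_delaunayComplex {L : Set (FlatTorus d)} {G : WitnessGrid d}
    {lam mu Θ₀ : ℝ}
    (h : ∀ σ ∈ keptComplex L G lam mu Θ₀, σ.card = d + 1 →
      ∃ η > 0, ∃ c, IsCircumcenter σ c ∧ IsProtectedAt L η σ c) :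
    keptComplex L G lam mu Θ₀ ⊆ delaunayComplex L := by
  rintro τ ⟨hτ, σ, hσ, hτσ⟩
  obtain ⟨η, hη, c, hc, hprot⟩ := h σ ⟨hτ.mono hτσ, σ, hσ, subset_rfl⟩ hσ.2.1
  refine ⟨hτ, fun p hp => hσ.1 (hτσ hp), c, fun p hp q hq => ?_⟩
  by_cases hqσ : q ∈ σ
  · exact (hc p (hτσ hp) q hqσ).le
  · have := hprot p (hτσ hp) q ⟨hq, hqσ⟩
    linarith

end FlatDelaunay

open FlatDelaunay
theorem mainTheorem7
    (d : ℕ) (hd : 1 ≤ d)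
    (lam mu rho : ℝ) (hlam : lam ≤ 1 / 4) (hmu : 0 < mu) (hrho : 0 ≤ rho) (hrho_mu : rho < mu / 4)
    (L : Finset (FlatTorus d)) (hL : IsNet (L : Set (FlatTorus d)) lam mu)
    (f : FlatTorus d → FlatTorus d) (hf : ∀ p ∈ L, dist (f p) p ≤ rho * lam)
    (L' : Set (FlatTorus d)) (hL' : L' = f '' (L : Set (FlatTorus d)))
    (lam' mu' : ℝ) (hlam' : lam' = lam * (1 + rho)) (hmu' : mu' = (mu - 2 * rho) / (1 + rho))
    (G : WitnessGrid d)
    (δ δbar : ℝ) (hδ : δ = δbar * lam') (hδε : 4 * (2 * G.eps) + δ ≤ lam')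
    (hprot : ∀ σ ∈ delaunayComplex L', σ.card = d + 1 →
      ∀ c, IsDelaunayCenter L' σ c → IsProtectedAt L' δ σ c)
    (Θ₀ : ℝ) (hΘ₀ : 0 < Θ₀) (hΘ₀_le : Θ₀ ≤ δbar * mu / (24 * d)) :
    delaunayComplex L' ⊆ keptComplex L' G lam' mu' Θ₀ ∧
    ((∀ σ ∈ keptComplex L' G lam' mu' Θ₀, σ.card = d + 1 →
        ∃ η > 0, ∃ c, IsCircumcenter σ c ∧ IsProtectedAt L' η σ c) →
      keptComplex L' G lam' mu' Θ₀ = delaunayComplex L') := by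
  obtain ⟨hlam0, hmu2⟩ := hL.sparsity_lt_two hd (by linarith)
  have hd1 : (1 : ℝ) ≤ d := Nat.one_le_cast.2 hd
  have hnet : IsNet L' lam' mu' := by
    rw [hL', hlam', hmu']
    exact hL.image hrho hf
  -- From `mu < 2` follows `rho < 1 / 2`. The same bound turns `hΘ₀_le` into `12 * d * Θ₀ ≤ δbar`
  -- below.
  have hlam38 : lam' ≤ 3 / 8 := by
    rw [hlam']
    nlinarith
  have hmu'0 : 0 < mu' := by
    rw [hmu']
    exact div_pos (by linarith) (by linarith)
  have hmu'2 : mu' ≤ 2 := by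
    rw [hmu', div_le_iff₀ (by linarith)]
    linarith
  have hδmu : Θ₀ * (24 * d) ≤ δbar * mu := (le_div_iff₀ (by positivity)).1 hΘ₀_le
  have hδbar : 0 < δbar := by
    have : 0 < δbar * mu := lt_of_lt_of_le (by positivity) hδmu
    exact pos_of_mul_pos_left this hmu.le
  have hsub := delaunayComplex_subset_keptComplex hd (hL' ▸ L.finite_toSet.image f) hlam38 hmu'0
    hmu'2 hnet G hδ hδbar (by linarith) hprot hΘ₀ (by nlinarith)
  exact ⟨hsub, fun h => (keptComplex_subset_delaunayComplex h).antisymm hsub⟩
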